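/- Let $d\ge 1$. Let $\Delta$ be a regular $(d+1)$-simplex inscribed in the unit sphere $S^d\subset\mathbb{R}^{d+1}$, let $\tau$ be a closed facet of $\Delta$, let $\Phi(x)=x/\|x\|$, and put $\lambda_d=\operatorname{diam}\Phi(\tau)$ (this does not depend on the choice of $\Delta$ and $\tau$). For $n\ge 1$ and $\epsilon>0$, the random Borsuk graph $\mathrm{Bor}^d(\epsilon,n)$ has as vertices $n$ independent, uniformly distributed random points $X_1,\dots,X_n$ of $S^d$, and $X_i$, $X_j$ with $i\ne j$ are joined by an edge if and only if $\|X_i-X_j\|>2-\epsilon$, where $\|\cdot\|$ is the Euclidean norm of $\mathbb{R}^{d+1}$. Suppose that the sequence $\epsilon(n)$ satisfies $$\frac{64}{3}\left(\frac{3\pi^2}{4}\right)^{1/d}\left(\frac{\log n}{n}\right)^{2/d}\le \epsilon(n)\le 2-\lambda_d$$ for all sufficiently large $n$. Then $\chi\bigl(\mathrm{Bor}^d(\epsilon(n),n)\bigr)=d+2$ asymptotically almost surely, that is, $$\lim_{n\to\infty}\mathbb{P}\bigl[\chi\bigl(\mathrm{Bor}^d(\epsilon(n),n)\bigr)=d+2\bigr]=1.$$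 -/

import Mathlib

open MeasureTheory ProbabilityTheory Filter
open scoped Topology

/-- The unit sphere `S^d` in `ℝ^(d+1)`, with the Euclidean distance of the ambient space. -/
abbrev UnitSphere (d : ℕ) : Type :=
  Metric.sphere (0 : EuclideanSpace ℝ (Fin (d + 1))) 1

/-- The uniform probability measure on `S^d`: surface area, normalized to total mass one. -/
noncomputable def uniformSphere (d : ℕ) : Measure (UnitSphere d) :=
  ((volume : Measure (EuclideanSpace ℝ (Fin (d + 1)))).toSphere Set.univ)⁻¹ •
    (volume : Measure (EuclideanSpace ℝ (Fin (d + 1)))).toSphere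

/-- The normalized area is a probability measure. -/
instance uniformSphere_isProbabilityMeasure (d : ℕ) :
    IsProbabilityMeasure (uniformSphere d) := by
  constructor
  rw [uniformSphere, Measure.smul_apply, smul_eq_mul]
  refine ENNReal.inv_mul_cancel ?_ (measure_ne_top _ _)
  rw [Ne, Measure.measure_univ_eq_zero]
  exact Measure.toSphere_ne_zero _

/-- The Borsuk graph on the points `x 1, …, x n` of `S^d`: two different indices are joined
if and only if the Euclidean distance of their points is more than `2 - ε`. -/
def borsukGraph {d n : ℕ} (ε : ℝ) (x : Fin n → UnitSphere d) : SimpleGraph (Fin n) where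
  Adj i j := i ≠ j ∧ 2 - ε < dist (x i) (x j)
  symm := ⟨fun _ _ h => ⟨h.1.symm, by rw [dist_comm]; exact h.2⟩⟩
  loopless := ⟨fun _ h => h.1 rfl⟩

/-- A regular `(d+1)`-simplex inscribed in `S^d`: all its edges have the same length and all its
vertices are unit vectors. -/
structure IsRegularInscribed {d : ℕ}
    (Δ : Affine.Simplex ℝ (EuclideanSpace ℝ (Fin (d + 1))) (d + 1)) : Prop where
  equilateral : Δ.Equilateral
  norm_eq_one : ∀ i, ‖Δ.points i‖ = 1

/-- The diameter of the image, under the radial projection `x ↦ x / ‖x‖`, of the (closed) facet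
of `Δ` opposite to the vertex `i`. For a regular inscribed simplex this is the constant `λ_d`. -/
noncomputable def facetProjDiam {d : ℕ}
    (Δ : Affine.Simplex ℝ (EuclideanSpace ℝ (Fin (d + 1))) (d + 1)) (i : Fin (d + 2)) : ℝ :=
  Metric.diam ((fun x : EuclideanSpace ℝ (Fin (d + 1)) => ‖x‖⁻¹ • x) ''
    (Δ.faceOpposite i).closedInterior)

/-- Unit vectors with pairwise inner products `-1/(d+1)` exist, so that there is a regular simplex
inscribed in the sphere. -/
theorem exists_isRegularInscribed (d : ℕ) :
    ∃ Δ : Affine.Simplex ℝ (EuclideanSpace ℝ (Fin (d + 1))) (d + 1), IsRegularInscribed Δ := by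
  obtain ⟨p, hp⟩ : ∃ p : Fin (d + 2) → EuclideanSpace ℝ (Fin (d + 1)),
      ∀ i j, inner ℝ (p i) (p j) = if i = j then (1 : ℝ) else -1 / (d + 1) := by
    have hm : (0 : ℝ) < d + 1 := by positivity
    obtain ⟨a, ha⟩ : ∃ a : ℝ, a ^ 2 = 1 + 1 / (d + 1) :=
      ⟨√(1 + 1 / (d + 1)), Real.sq_sqrt (by positivity)⟩
    obtain ⟨c, hc⟩ : ∃ c : ℝ, c ^ 2 = 1 / (d + 1) :=
      ⟨√(1 / (d + 1)), Real.sq_sqrt (by positivity)⟩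
    obtain ⟨b, hb⟩ : ∃ b : ℝ, a + (d + 1) * b = c := ⟨(c - a) / (d + 1), by field_simp; ring⟩
    have h1 : 2 * a * b + (d + 1) * b ^ 2 = -1 / (d + 1) := by
      have h : (d + 1) * (2 * a * b + (d + 1) * b ^ 2) = c ^ 2 - a ^ 2 := by rw [← hb]; ring
      rw [hc, ha] at h
      rw [eq_div_iff hm.ne']
      linarith
    have h2 : (d + 1) * c ^ 2 = (1 : ℝ) := by rw [hc]; field_simp
    have h3 : -(c * (a + (d + 1) * b)) = -1 / (d + 1) := by
      rw [hb, ← pow_two, hc]; ring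
    refine ⟨Fin.lastCases (WithLp.toLp 2 fun _ => -c)
      (fun i => WithLp.toLp 2 fun k => (if k = i then a else 0) + b), fun i j => ?_⟩
    rw [PiLp.inner_apply]
    induction i using Fin.lastCases with
    | last =>
      induction j using Fin.lastCases with
      | last =>
        simp
        linarith
      | cast j =>
        have : Fin.last (d + 1) ≠ j.castSucc := (Fin.castSucc_lt_last j).ne'
        simp [this, add_mul, Finset.sum_add_distrib]
        linarith
    | cast i =>
      induction j using Fin.lastCases with
      | last =>
        have : i.castSucc ≠ Fin.last (d + 1) := (Fin.castSucc_lt_last i).ne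
        simp [this, mul_add, Finset.sum_add_distrib]
        linarith
      | cast j =>
        by_cases hij : i = j
        · subst hij
          simp [add_sq, Finset.sum_add_distrib, ite_pow]
          have : -1 / ((d : ℝ) + 1) = 1 - a ^ 2 := by rw [ha]; ring
          linarith
        · simp [Finset.sum_add_distrib, add_mul, mul_add, hij]
          linarith
  have hn : ∀ i, ‖p i‖ = 1 := fun i => by
    have := hp i i
    rw [if_pos rfl, real_inner_self_eq_norm_sq] at this
    exact (pow_eq_one_iff_of_nonneg (norm_nonneg _) two_ne_zero).1 this
  have hm : (0 : ℝ) < d + 1 := by positivity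
  have hind : AffineIndependent ℝ p := by
    rw [affineIndependent_iff]
    intro s w hw hs i hi
    have h := congrArg (fun v => inner ℝ v (p i)) hs
    simp only [sum_inner, inner_smul_left, hp, inner_zero_left] at h
    have key : ∀ j, w j * (if j = i then (1 : ℝ) else -1 / (d + 1)) =
        w j * (-1 / (d + 1)) + if j = i then w j * (1 + 1 / (d + 1)) else 0 := by
      intro j
      split_ifs <;> ring
    simp only [conj_trivial, key, Finset.sum_add_distrib, ← Finset.sum_mul, hw, zero_mul,
      zero_add, Finset.sum_ite_eq', hi, if_true] at h
    have : (0 : ℝ) < 1 + 1 / (d + 1) := by positivity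
    exact (mul_eq_zero.1 h).resolve_right this.ne'
  refine ⟨⟨p, hind⟩, ⟨⟨√(2 + 2 / (d + 1)), fun i j hij => ?_⟩, hn⟩⟩
  rw [dist_eq_norm, eq_comm, Real.sqrt_eq_iff_mul_self_eq (by positivity) (norm_nonneg _),
    ← pow_two, norm_sub_sq_real, hn, hn, hp, if_neg hij]
  ring

/-! The upper bound is deterministic. The radial projections of the `d + 2` facets of the simplex
cover the sphere. Colouring each point by a facet whose projection contains it is proper, since
points of one colour are at distance at most `λ_d ≤ 2 - ε`.

The lower bound needs the sample to be dense. If every point of the sphere has a sample point within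
`a`, a colouring of the graph with `d + 1` colours colours the whole sphere. By the
Lusternik–Schnirelmann property (`exists_near_antipodal`) two almost antipodal points get the same
colour. Their sample points `p`, `q` have `‖p + q‖` barely above `2 * a` at most, so by the
parallelogram law they are adjacent once `4 * a ^ 2 < 4 * ε - ε ^ 2`.

The Lusternik–Schnirelmann property is proved by a mod 2 version of Tucker's lemma. A colouring
without such a pair gives an antipodal labelling with only `d` absolute values. The alternation of
labels is a cochain `α` with `cobd α = α + α ∘ (-)` on small simplices, and it vanishes on `d + 1`
vertices. The adjoint of barycentric subdivision carries it to the faces of the cross-polytope.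
There its sum over the octahedral sphere on `k` axes does not depend on `k`: it is `1` for `k = 0`
and `0` for `k = d + 1`.

Density holds with high probability by a union bound over a net (`exists_net_parameters`): packing
bounds give a net of `O(n / log n)` points, while each ball is missed with probability at most `1 /
n`. -/

/-! ### Mod 2 cochains on lists of vertices. -/

section Cochains

variable {V W : Type*}

/-- The coboundary of a mod 2 cochain on lists of vertices: the sum of the values on all lists
obtained by deleting one entry. The empty list is a simplex, so that this is augmented. -/
def cobd (α : List V → ZMod 2) : List V → ZMod 2
  | [] => 0
  | a :: l => α l + cobd (fun t => α (a :: t)) l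

theorem cobd_congr {α β : List V → ZMod 2} {l : List V}
    (h : ∀ t, t.Sublist l → t.length + 1 = l.length → α t = β t) : cobd α l = cobd β l := by
  induction l generalizing α β with
  | nil => rfl
  | cons a l ih =>
    rw [cobd, cobd, h l (List.sublist_cons_self a l) rfl]
    congr 1
    exact ih fun t ht hl => h _ (ht.cons_cons a) (by simp [hl])

theorem cobd_add (α β : List V → ZMod 2) (l : List V) :
    cobd (fun t => α t + β t) l = cobd α l + cobd β l := by
  induction l generalizing α β with
  | nil => simp [cobd]
  | cons a l ih =>
    simp only [cobd, ih]
    ring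

theorem cobd_const_mul (c : ZMod 2) (α : List V → ZMod 2) (l : List V) :
    cobd (fun t => c * α t) l = c * cobd α l := by
  induction l generalizing α with
  | nil => simp [cobd]
  | cons a l ih =>
    simp only [cobd, ih]
    ring

theorem cobd_cobd (α : List V → ZMod 2) (l : List V) : cobd (cobd α) l = 0 := by
  induction l generalizing α with
  | nil => rfl
  | cons a l ih =>
    simp only [cobd, cobd_add, ih, add_zero]
    exact CharTwo.add_self_eq_zero _

theorem cobd_map (g : V → W) (α : List W → ZMod 2) (l : List V) :
    cobd (fun t => α (t.map g)) l = cobd α (l.map g) := by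
  induction l generalizing α with
  | nil => rfl
  | cons a l ih =>
    simp only [cobd, List.map_cons]
    rw [← ih (fun t => α (g a :: t))]

theorem cobd_perm {α : List V → ZMod 2} (hα : ∀ s t : List V, s.Perm t → α s = α t)
    {l l' : List V} (h : l.Perm l') : cobd α l = cobd α l' := by
  induction h generalizing α with
  | nil => rfl
  | cons a h ih =>
    simp only [cobd, hα _ _ h, ih fun s t hst => hα _ _ (hst.cons a)]
  | swap a b l =>
    simp only [cobd]
    rw [cobd_congr (α := fun t => α (b :: a :: t)) (β := fun t => α (a :: b :: t))
      fun t _ _ => hα _ _ (.swap ..)]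
    ring
  | trans _ _ ih₁ ih₂ => rw [ih₁ hα, ih₂ hα]

end Cochains

/-! ### Alternation of signed labels. -/

section Labels

/-- The cup power of the mod 2 coboundary of the parity of labels. -/
def parityCup : List ℕ → ZMod 2
  | [] => 0
  | [_] => 1
  | x :: y :: t => ((x : ZMod 2) + y) * parityCup (y :: t)

/-- The cochain that detects lists of labels of alternating parity and odd first entry. -/
def alternating : List ℕ → ZMod 2
  | [] => 1
  | x :: t => (x : ZMod 2) * parityCup (x :: t)

theorem alternating_cons (x : ℕ) (t : List ℕ) :
    alternating (x :: t) = (x : ZMod 2) * parityCup (x :: t) := rfl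

/-- The label of the opposite sign: labels are `2 * i` and `2 * i + 1`. -/
def flipLabel (x : ℕ) : ℕ := if x % 2 = 0 then x + 1 else x - 1

theorem cast_flipLabel (x : ℕ) : (flipLabel x : ZMod 2) = x + 1 := by
  unfold flipLabel
  split_ifs with h
  · push_cast; rfl
  · have : x = (x - 1) + 1 := by omega
    conv_rhs => rw [this]
    push_cast
    rw [add_assoc, CharTwo.add_self_eq_zero, add_zero]

/-- This is the cocycle identity `cobd parityCup (x :: t) = 0` with its first term moved to the
right. It forces the value `0` on the empty list. -/
theorem cobd_parityCup_cons (x : ℕ) (t : List ℕ) :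
    cobd (fun u => parityCup (x :: u)) t = parityCup t := by
  induction t generalizing x with
  | nil => rfl
  | cons y u ih =>
    simp only [cobd, parityCup, cobd_const_mul, ih]
    cases u with
    | nil => simp [parityCup]
    | cons z r =>
      simp only [parityCup]
      linear_combination ((x : ZMod 2) * parityCup (z :: r)) * CharTwo.two_eq_zero (R := ZMod 2)

theorem parityCup_map_flipLabel (l : List ℕ) : parityCup (l.map flipLabel) = parityCup l := by
  induction l with
  | nil => rfl
  | cons x t ih =>
    cases t with
    | nil => rfl
    | cons y r =>
      simp only [List.map_cons, parityCup, cast_flipLabel] at ih ⊢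
      rw [ih]
      linear_combination (parityCup (y :: r)) * CharTwo.two_eq_zero (R := ZMod 2)

/-- On a nonempty list both sides are `parityCup l`. With `p` the parity, `alternating` is `p ∪
(δp)^k`, whose coboundary is `(δp)^(k+1)`; flipping replaces `p` by `p + 1` and keeps `δp`. -/
theorem cobd_alternating (l : List ℕ) :
    cobd alternating l = alternating l + alternating (l.map flipLabel) := by
  cases l with
  | nil => simp [cobd, alternating, CharTwo.add_self_eq_zero]
  | cons x t =>
    have h := parityCup_map_flipLabel (x :: t)
    rw [List.map_cons] at h
    simp only [cobd, alternating_cons, List.map_cons, h, cast_flipLabel, cobd_const_mul,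
      cobd_parityCup_cons]
    have key : alternating t + x * parityCup t = parityCup (x :: t) := by
      cases t with
      | nil => simp [alternating, parityCup]
      | cons y r => simp only [alternating, parityCup]; ring
    rw [key]
    linear_combination -(x : ZMod 2) * parityCup (x :: t) * CharTwo.two_eq_zero (R := ZMod 2)

/-- No two labels of the list are opposite. -/
def NoComplementary (l : List ℕ) : Prop := ∀ x ∈ l, ∀ y ∈ l, x / 2 = y / 2 → x = y

/-- Alternation of a list of labels in increasing order. -/
def sortedAlternating (l : List ℕ) : ZMod 2 := alternating (l.insertionSort (· ≤ ·))

theorem sortedAlternating_perm (s t : List ℕ) (h : s.Perm t) :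
    sortedAlternating s = sortedAlternating t := by
  unfold sortedAlternating
  congr 1
  exact ((List.perm_insertionSort _ _).trans (h.trans (List.perm_insertionSort _ _).symm)).eq_of_pairwise
    (fun a b _ _ h1 h2 => le_antisymm h1 h2)
    (List.pairwise_insertionSort _ _) (List.pairwise_insertionSort _ _)

theorem sortedAlternating_of_pairwise {l : List ℕ} (h : l.Pairwise (· ≤ ·)) :
    sortedAlternating l = alternating l := by
  rw [sortedAlternating, List.Pairwise.insertionSort_eq h]

/-- Flipping exchanges `2 * i` and `2 * i + 1`, so it preserves the weak order as long as no two
labels are opposite. Sorting therefore commutes with flipping. -/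
theorem cobd_sortedAlternating {l : List ℕ} (hl : NoComplementary l) :
    cobd sortedAlternating l = sortedAlternating l + sortedAlternating (l.map flipLabel) := by
  have hp := List.perm_insertionSort (· ≤ ·) l
  have hs : (l.insertionSort (· ≤ ·)).Pairwise (· ≤ ·) := List.pairwise_insertionSort _ _
  rw [← cobd_perm sortedAlternating_perm hp, ← sortedAlternating_perm _ _ hp,
    ← sortedAlternating_perm _ _ (hp.map flipLabel)]
  have hl' : NoComplementary (l.insertionSort (· ≤ ·)) := fun x hx y hy =>
    hl x (hp.subset hx) y (hp.subset hy)
  generalize l.insertionSort (· ≤ ·) = m at *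
  have hflip : (m.map flipLabel).Pairwise (· ≤ ·) := by
    rw [List.pairwise_map]
    refine hs.imp_of_mem fun {x y} hx hy hxy => ?_
    have := hl' x hx y hy
    unfold flipLabel
    split_ifs <;> omega
  rw [sortedAlternating_of_pairwise hs, sortedAlternating_of_pairwise hflip, ← cobd_alternating]
  exact cobd_congr fun t ht _ => sortedAlternating_of_pairwise (hs.sublist ht)

/-- Pigeonhole: two neighbours in the sorted list share an absolute value, hence are equal, and
their factor vanishes. -/
theorem parityCup_eq_zero {l : List ℕ} (hs : l.Pairwise (· ≤ ·)) (hl : NoComplementary l)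
    {a b : ℕ} (hb : ∀ x ∈ l, a ≤ x / 2 ∧ x / 2 < b) (hlen : b - a < l.length) :
    parityCup l = 0 := by
  induction l generalizing a with
  | nil => simp at hlen
  | cons x t ih =>
    cases t with
    | nil =>
      have := hb x (by simp)
      simp at hlen
      omega
    | cons y r =>
      rw [parityCup]
      by_cases hxy : x / 2 = y / 2
      · rw [hl x (by simp) y (by simp) hxy, CharTwo.add_self_eq_zero, zero_mul]
      · have hx := hb x (by simp)
        rw [List.pairwise_cons] at hs
        have hxy' := hs.1 y (by simp)
        rw [ih hs.2 (fun u hu v hv => hl u (List.mem_cons_of_mem _ hu) v (List.mem_cons_of_mem _ hv))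
          (a := a + 1), mul_zero]
        · intro z hz
          have h1 := hb z (List.mem_cons_of_mem _ hz)
          have h2 : y ≤ z := by
            rcases List.mem_cons.1 hz with rfl | hz
            · exact le_rfl
            · exact (List.pairwise_cons.1 hs.2).1 z hz
          omega
        · simp only [List.length_cons] at hlen ⊢
          omega

theorem sortedAlternating_eq_zero {l : List ℕ} (hl : NoComplementary l) {d : ℕ}
    (hb : ∀ x ∈ l, x < 2 * d) (hlen : d < l.length) : sortedAlternating l = 0 := by
  have hp := List.perm_insertionSort (· ≤ ·) l
  rw [sortedAlternating]
  have h : parityCup (l.insertionSort (· ≤ ·)) = 0 :=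
    parityCup_eq_zero (a := 0) (b := d) (List.pairwise_insertionSort _ _)
      (fun x hx y hy => hl x (hp.subset hx) y (hp.subset hy))
      (fun x hx => ⟨Nat.zero_le _, by have := hb x (hp.subset hx); omega⟩)
      (by rw [hp.length_eq]; omega)
  have hne := hp.length_eq
  generalize l.insertionSort (· ≤ ·) = m at *
  cases m with
  | nil => simp at hne; omega
  | cons x t => rw [alternating, h, mul_zero]

end Labels

/-! ### Barycentric subdivision acting on cochains. -/

section Subdivision

variable {E : Type*} [NormedAddCommGroup E] [NormedSpace ℝ E]

/-- The barycenter of a list of points. -/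
noncomputable def barycenter (l : List E) : E := (l.length : ℝ)⁻¹ • l.sum

/-- The adjoint of barycentric subdivision, evaluated on lists of the given length. -/
noncomputable def subdivAux : ℕ → (List E → ZMod 2) → List E → ZMod 2
  | 0, α, l => α l
  | n + 1, α, l => cobd (subdivAux n fun t => α (barycenter l :: t)) l

/-- The adjoint of barycentric subdivision. -/
noncomputable def subdiv (α : List E → ZMod 2) (l : List E) : ZMod 2 := subdivAux l.length α l

theorem barycenter_map_neg (l : List E) : barycenter (l.map fun x => -x) = -barycenter l := by
  have h : (l.map fun x => -x).sum = -l.sum := by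
    induction l with
    | nil => simp
    | cons a l ih => simp [ih]; abel
  simp [barycenter, h]

theorem subdivAux_add (n : ℕ) (α β : List E → ZMod 2) (l : List E) :
    subdivAux n (fun t => α t + β t) l = subdivAux n α l + subdivAux n β l := by
  induction n generalizing α β l with
  | zero => rfl
  | succ n ih =>
    simp only [subdivAux]
    rw [← cobd_add]
    congr 1
    funext t
    exact ih _ _ _

theorem subdivAux_neg (n : ℕ) (α : List E → ZMod 2) (l : List E) :
    subdivAux n (fun t => α (t.map fun x => -x)) l = subdivAux n α (l.map fun x => -x) := by
  induction n generalizing α l with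
  | zero => rfl
  | succ n ih =>
    simp only [subdivAux, List.map_cons]
    rw [← cobd_map, barycenter_map_neg]
    congr 1
    funext t
    exact ih (fun u => α (-barycenter l :: u)) t

/-- Expanding `cobd α` on a cone from the barycenter leaves the base term and a term that, by
induction, is a double coboundary. -/
theorem cobd_subdivAux (n : ℕ) (α : List E → ZMod 2) (l : List E) (hl : l.length = n + 1) :
    cobd (subdivAux n α) l = subdivAux (n + 1) (cobd α) l := by
  induction n generalizing α l with
  | zero =>
    obtain ⟨a, rfl⟩ := List.length_eq_one_iff.1 hl
    simp [subdivAux, cobd]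
  | succ n ih =>
    have h : subdivAux (n + 1 + 1) (cobd α) l = cobd (fun u => subdivAux (n + 1) α u +
        subdivAux (n + 1) (cobd fun t => α (barycenter l :: t)) u) l :=
      cobd_congr fun u _ _ => subdivAux_add (n + 1) α (cobd fun t => α (barycenter l :: t)) u
    rw [h, cobd_add, left_eq_add, ← cobd_cobd (subdivAux n fun t => α (barycenter l :: t)) l]
    exact cobd_congr fun t _ ht => (ih (fun t => α (barycenter l :: t)) t (by omega)).symm

theorem dist_barycenter_le {l : List E} {M : ℝ} (hM : ∀ x ∈ l, ∀ y ∈ l, dist x y ≤ M)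
    {v : E} (hv : v ∈ l) : dist (barycenter l) v ≤ (1 - 1 / l.length) * M := by
  obtain ⟨s, t, rfl⟩ := List.append_of_mem hv
  have aux : ∀ u : List E, (∀ x ∈ u, dist x v ≤ M) →
      ‖(u.map fun x => x - v).sum‖ ≤ u.length * M := by
    intro u hu
    induction u with
    | nil => simp
    | cons a u ih =>
      simp only [List.map_cons, List.sum_cons, List.length_cons]
      have h1 := hu a (by simp)
      rw [dist_eq_norm] at h1
      have h2 := ih fun x hx => hu x (List.mem_cons_of_mem _ hx)
      push_cast
      linarith [norm_add_le (a - v) (u.map fun x => x - v).sum]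
  have sumsub : ∀ u : List E, (u.map fun x => x - v).sum = u.sum - (u.length : ℝ) • v := by
    intro u
    induction u with
    | nil => simp
    | cons a u ih => simp [ih, add_smul]; abel
  have hn : (0 : ℝ) < ((s ++ v :: t).length : ℝ) := by simp; positivity
  have key : barycenter (s ++ v :: t) - v = ((s ++ v :: t).length : ℝ)⁻¹ •
      ((s ++ t).map fun x => x - v).sum := by
    have : ((s ++ t).map fun x => x - v).sum = ((s ++ v :: t).map fun x => x - v).sum := by simp
    rw [this, sumsub, smul_sub, inv_smul_smul₀ hn.ne', barycenter]
  rw [dist_eq_norm, key, norm_smul, Real.norm_of_nonneg (by positivity)]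
  have h := aux (s ++ t) fun x hx => hM x (by simp at hx ⊢; tauto) v (by simp)
  have hlen : ((s ++ v :: t).length : ℝ) = (s ++ t).length + 1 := by
    simp only [List.length_append, List.length_cons]; push_cast; ring
  rw [hlen] at hn ⊢
  calc _ ≤ (((s ++ t).length : ℝ) + 1)⁻¹ * ((s ++ t).length * M) := by gcongr
    _ = _ := by field_simp; ring

theorem barycenter_mem {C : Set E} (hC : Convex ℝ C) {l : List E} (hl : ∀ x ∈ l, x ∈ C)
    (hne : l ≠ []) : barycenter l ∈ C := by
  have key : ∀ u : List E, (∀ x ∈ u, x ∈ C) → u ≠ [] → (u.length : ℝ)⁻¹ • u.sum ∈ C := by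
    intro u hu hne
    induction u with
    | nil => exact absurd rfl hne
    | cons a u ih =>
      by_cases hu0 : u = []
      · subst hu0
        simpa using hu a (by simp)
      · have h1 := ih (fun x hx => hu x (List.mem_cons_of_mem _ hx)) hu0
        have hpos : (0 : ℝ) < u.length := by
          exact_mod_cast List.length_pos_iff.2 hu0
        have h2 := hC (hu a (by simp)) h1 (a := (u.length + 1 : ℝ)⁻¹)
          (b := (u.length + 1 : ℝ)⁻¹ * u.length) (by positivity) (by positivity) (by field_simp; ring)
        rw [mul_smul, smul_inv_smul₀ hpos.ne', ← smul_add] at h2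
        simpa using h2
  exact key l hl hne

/-- The subdivision of a simplex only evaluates the cochain on simplices in the same convex set with
diameter smaller by the factor `1 - 1 / D`. -/
theorem subdivAux_congr {D : ℕ} {α β : List E → ZMod 2} {l : List E} {M : ℝ} (hM0 : 0 ≤ M)
    (n : ℕ) (hn : l.length = n) (hD : n ≤ D) {C : Set E} (hC : Convex ℝ C) (hl : ∀ x ∈ l, x ∈ C)
    (hM : ∀ x ∈ l, ∀ y ∈ l, dist x y ≤ M)
    (h : ∀ t : List E, t.length = n → (∀ x ∈ t, x ∈ C) →
      (∀ x ∈ t, ∀ y ∈ t, dist x y ≤ (1 - 1 / D) * M) → α t = β t) :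
    subdivAux n α l = subdivAux n β l := by
  induction n generalizing α β l C with
  | zero =>
    rw [List.length_eq_zero_iff] at hn
    subst hn
    exact h [] rfl (by simp) (by simp)
  | succ n ih =>
    have hq : (1 - 1 / (l.length : ℝ)) * M ≤ (1 - 1 / D) * M := by
      have h0 : (0 : ℝ) < l.length := by rw [hn]; positivity
      have h1 : (l.length : ℝ) ≤ D := by rw [hn]; exact_mod_cast hD
      gcongr
    have hlne : l ≠ [] := by rintro rfl; simp at hn
    rw [subdivAux, subdivAux]
    refine cobd_congr fun t ht htl => ?_
    -- Intersecting with a ball keeps all later barycenters close to the present one, by convexity.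
    refine ih (C := C ∩ Metric.closedBall (barycenter l) ((1 - 1 / D) * M)) (by omega) (by omega)
      (hC.inter (convex_closedBall _ _))
      (fun x hx => ⟨hl x (ht.subset hx), ?_⟩)
      (fun x hx y hy => hM x (ht.subset hx) y (ht.subset hy)) fun u hu huC huM => ?_
    · rw [Metric.mem_closedBall, dist_comm]
      exact (dist_barycenter_le hM (ht.subset hx)).trans hq
    · have hqM : 0 ≤ (1 - 1 / (D : ℝ)) * M := by
        have : (1 : ℝ) ≤ D := by exact_mod_cast (by omega : 1 ≤ D)
        have : 1 / (D : ℝ) ≤ 1 := by rw [div_le_one (by positivity)]; exact this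
        exact mul_nonneg (by linarith) hM0
      refine h _ (by simp [hu]) ?_ ?_
      · intro x hx
        rcases List.mem_cons.1 hx with rfl | hx
        · exact barycenter_mem hC hl hlne
        · exact (huC x hx).1
      · intro x hx y hy
        rcases List.mem_cons.1 hx with rfl | hx <;> rcases List.mem_cons.1 hy with rfl | hy
        · simpa using hqM
        · rw [dist_comm]; exact (huC y hy).2
        · exact (huC x hx).2
        · exact huM x hx y hy

/-- A cochain that behaves like the alternation of an antipodal labelling on all simplices with at
most `D` vertices in one of the sets of `F` and of diameter at most `M`. -/
structure IsAntipodalCochain (F : Set (Set E)) (D : ℕ) (M : ℝ) (α : List E → ZMod 2) : Prop where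
  nil : α [] = 1
  cobd_eq : ∀ C ∈ F, ∀ l : List E, l.length ≤ D → (∀ x ∈ l, x ∈ C) →
    (∀ x ∈ l, ∀ y ∈ l, dist x y ≤ M) → cobd α l = α l + α (l.map fun x => -x)
  eq_zero : ∀ C ∈ F, ∀ l : List E, l.length = D → (∀ x ∈ l, x ∈ C) →
    (∀ x ∈ l, ∀ y ∈ l, dist x y ≤ M) → α l = 0

theorem IsAntipodalCochain.subdiv {F : Set (Set E)} (hF : ∀ C ∈ F, Convex ℝ C)
    {D : ℕ} {M : ℝ} (hM0 : 0 ≤ M)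
    {α : List E → ZMod 2} (h : IsAntipodalCochain F D ((1 - 1 / D) * M) α) :
    IsAntipodalCochain F D M (subdiv α) where
  nil := h.nil
  cobd_eq C hC l hlD hlC hlM := by
    cases hl : l.length with
    | zero =>
      rw [List.length_eq_zero_iff] at hl
      subst hl
      exact (CharTwo.add_self_eq_zero _).symm
    | succ n =>
      have h1 : cobd (_root_.subdiv α) l = cobd (subdivAux n α) l :=
        cobd_congr fun t _ ht => by rw [_root_.subdiv, show t.length = n by omega]
      rw [h1, cobd_subdivAux n α l hl, _root_.subdiv, _root_.subdiv, List.length_map, hl,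
        ← subdivAux_neg, ← subdivAux_add]
      exact subdivAux_congr hM0 _ hl (hl ▸ hlD) (hF C hC) hlC hlM fun t ht htC htM =>
        h.cobd_eq C hC t (by omega) htC htM
  eq_zero C hC l hlD hlC hlM := by
    have h0 : ∀ n, ∀ u : List E, subdivAux n (fun _ => 0) u = 0 := by
      intro n u
      have := subdivAux_add n (fun _ => 0) (fun _ => 0) u
      simpa using this
    rw [_root_.subdiv, ← h0 l.length l]
    exact subdivAux_congr hM0 _ rfl hlD.le (hF C hC) hlC hlM fun t ht htC htM =>
      h.eq_zero C hC t (by omega) htC htM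

/-- Enough subdivisions, with `(1 - 1 / D) ^ N * M < m`, carry a cochain from the fine scale `m` to
the coarse scale `M`. -/
theorem IsAntipodalCochain.exists_of_pos {F : Set (Set E)} (hF : ∀ C ∈ F, Convex ℝ C)
    {D : ℕ} (hD : 1 ≤ D) {M m : ℝ} (hM0 : 0 ≤ M) (hm : 0 < m)
    {α : List E → ZMod 2} (h : IsAntipodalCochain F D m α) :
    ∃ β, IsAntipodalCochain F D M β := by
  have hD' : (1 : ℝ) ≤ D := by exact_mod_cast hD
  have hq0 : 0 ≤ 1 - 1 / (D : ℝ) := by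
    rw [sub_nonneg, div_le_one (by positivity)]; exact hD'
  have hq1 : 1 - 1 / (D : ℝ) < 1 := by
    have : 0 < 1 / (D : ℝ) := by positivity
    linarith
  have key : ∀ N : ℕ, ∀ α : List E → ZMod 2, IsAntipodalCochain F D ((1 - 1 / (D : ℝ)) ^ N * M) α →
      ∃ β, IsAntipodalCochain F D M β := by
    intro N
    induction N with
    | zero => intro α h; exact ⟨α, by simpa using h⟩
    | succ N ih =>
      intro α h
      refine ih _ (IsAntipodalCochain.subdiv hF (α := α) (by positivity) ?_)
      rwa [← mul_assoc, ← pow_succ']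
  obtain ⟨N, hN⟩ := (((tendsto_pow_atTop_nhds_zero_of_lt_one hq0 hq1).mul_const M).eventually
    (gt_mem_nhds (by simpa using hm))).exists
  refine key N α ⟨h.nil, fun C hC l hl hlC hlM => h.cobd_eq C hC l hl hlC fun x hx y hy =>
    (hlM x hx y hy).trans hN.le, fun C hC l hl hlC hlM => h.eq_zero C hC l hl hlC fun x hx y hy =>
    (hlM x hx y hy).trans hN.le⟩

end Subdivision

/-! ### Sums over octahedral spheres. -/

section Octahedron

variable {E : Type*} [AddCommGroup E]

/-- The sum of a cochain over all lists of signed entries of a list. -/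
def octSum : List E → (List E → ZMod 2) → ZMod 2
  | [], α => α []
  | e :: es, α => octSum es (fun t => α (e :: t)) + octSum es (fun t => α (-e :: t))

theorem octSum_congr {es : List E} {α β : List E → ZMod 2}
    (h : ∀ l, List.Forall₂ (fun x e => x = e ∨ x = -e) l es → α l = β l) :
    octSum es α = octSum es β := by
  induction es generalizing α β with
  | nil => exact h [] .nil
  | cons e es ih =>
    rw [octSum, octSum, ih fun l hl => h _ (.cons (.inl rfl) hl),
      ih fun l hl => h _ (.cons (.inr rfl) hl)]

theorem octSum_add (es : List E) (α β : List E → ZMod 2) :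
    octSum es (fun t => α t + β t) = octSum es α + octSum es β := by
  induction es generalizing α β with
  | nil => rfl
  | cons e es ih => simp only [octSum, ih]; ring

theorem octSum_neg (es : List E) (α : List E → ZMod 2) :
    octSum es (fun t => α (t.map fun x => -x)) = octSum es α := by
  induction es generalizing α with
  | nil => rfl
  | cons e es ih =>
    simp only [octSum, List.map_cons, neg_neg]
    rw [ih (fun t => α (-e :: t)), ih (fun t => α (e :: t)), add_comm]

/-- The octahedral sphere is a cycle: deleting `e` and deleting `-e` leave the same face. -/
theorem octSum_cobd (es : List E) (α : List E → ZMod 2) : octSum es (cobd α) = 0 := by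
  induction es generalizing α with
  | nil => rfl
  | cons e es ih =>
    simp only [octSum, cobd, octSum_add, ih, add_zero]
    exact CharTwo.add_self_eq_zero _

/-- Replacing `l` by `-l` in the lower hemisphere pairs the terms to `cobd α (e :: l)`. Its part
other than `α l` is a coboundary in `l` and sums to zero. -/
theorem octSum_cons (e : E) (es : List E) {α : List E → ZMod 2}
    (h : ∀ l, List.Forall₂ (fun x e => x = e ∨ x = -e) l es →
      cobd α (e :: l) = α (e :: l) + α (-e :: l.map fun x => -x)) :
    octSum (e :: es) α = octSum es α := by
  rw [octSum, ← octSum_neg es (fun t => α (-e :: t)), ← octSum_add,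
    ← octSum_congr (α := fun l => cobd α (e :: l)) h]
  simp only [cobd, octSum_add, octSum_cobd, add_zero]

end Octahedron

/-! ### The Lusternik–Schnirelmann property. -/

section LusternikSchnirelmann

/-- An antipodal label attached to an integer colour `g`. -/
def antipodalLabel {E : Type*} [Neg E] (g : E → ℕ) (v : E) : ℕ := if g v < g (-v) then 2 * g v else 2 * g (-v) + 1

theorem antipodalLabel_neg {E : Type*} [AddGroup E] {g : E → ℕ} {v : E} (h : g v ≠ g (-v)) :
    antipodalLabel g (-v) = flipLabel (antipodalLabel g v) := by
  unfold antipodalLabel flipLabel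
  rw [neg_neg]
  split_ifs <;> omega

/-- The smaller of two distinct colours is never the last one, so `d + 1` colours give only `d`
absolute values. -/
theorem antipodalLabel_lt {E : Type*} [Neg E] {g : E → ℕ} {v : E} {d : ℕ} (h : g v ≠ g (-v)) (h1 : g v < d + 1)
    (h2 : g (-v) < d + 1) : antipodalLabel g v < 2 * d := by
  unfold antipodalLabel
  split_ifs <;> omega

theorem eq_neg_of_antipodalLabel {E : Type*} [Neg E] {g : E → ℕ} {v w : E}
    (h : antipodalLabel g v / 2 = antipodalLabel g w / 2)
    (hne : antipodalLabel g v ≠ antipodalLabel g w) : g v = g (-w) ∨ g w = g (-v) := by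
  unfold antipodalLabel at *
  split_ifs at * <;> omega

variable {E : Type*} [NormedAddCommGroup E] [NormedSpace ℝ E]

theorem norm_normalize_sub_le {v w : E} {c : ℝ} (hc : 0 < c) (hv : c ≤ ‖v‖) (hw : c ≤ ‖w‖) :
    ‖‖v‖⁻¹ • v - ‖w‖⁻¹ • w‖ ≤ 2 / c * ‖v - w‖ := by
  have hv0 : 0 < ‖v‖ := hc.trans_le hv
  have hw0 : 0 < ‖w‖ := hc.trans_le hw
  have h1 : ‖v‖⁻¹ • v - ‖w‖⁻¹ • w = ‖v‖⁻¹ • (v - w) + (‖v‖⁻¹ * (‖w‖ - ‖v‖) * ‖w‖⁻¹) • w := by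
    rw [show ‖v‖⁻¹ * (‖w‖ - ‖v‖) * ‖w‖⁻¹ = ‖v‖⁻¹ - ‖w‖⁻¹ by field_simp]
    rw [smul_sub, sub_smul]; abel
  have h2 : ‖(‖v‖⁻¹ * (‖w‖ - ‖v‖) * ‖w‖⁻¹) • w‖ = ‖v‖⁻¹ * |‖w‖ - ‖v‖| := by
    rw [norm_smul, norm_mul, norm_mul, norm_inv, norm_inv, norm_norm, norm_norm,
      Real.norm_eq_abs, mul_assoc, inv_mul_cancel₀ hw0.ne', mul_one]
  have h3 : |‖w‖ - ‖v‖| ≤ ‖v - w‖ := by rw [norm_sub_rev]; exact abs_norm_sub_norm_le w v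
  have h4 : ‖v‖⁻¹ ≤ 1 / c := by rw [inv_eq_one_div]; gcongr
  calc _ ≤ ‖‖v‖⁻¹ • (v - w)‖ + ‖(‖v‖⁻¹ * (‖w‖ - ‖v‖) * ‖w‖⁻¹) • w‖ := by
        rw [h1]; exact norm_add_le _ _
    _ ≤ ‖v‖⁻¹ * ‖v - w‖ + ‖v‖⁻¹ * ‖v - w‖ := by
        rw [h2, norm_smul, norm_inv, norm_norm]; gcongr
    _ = 2 * ‖v‖⁻¹ * ‖v - w‖ := by ring
    _ ≤ 2 * (1 / c) * ‖v - w‖ := by gcongr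
    _ = _ := by ring

theorem isAntipodalCochain_antipodalLabel {F : Set (Set E)} {d : ℕ} {g : E → ℕ} {c δ m : ℝ}
    (hc : 0 < c) (hF : ∀ C ∈ F, ∀ v ∈ C, c ≤ ‖v‖) (hg : ∀ v, g v < d + 1) (hδ : 0 < δ)
    (h : ∀ v w, v ≠ 0 → w ≠ 0 → g v = g w → δ ≤ ‖‖v‖⁻¹ • v + ‖w‖⁻¹ • w‖)
    (hm : 2 / c * m < δ) :
    IsAntipodalCochain F (d + 1) m fun l => sortedAlternating (l.map (antipodalLabel g)) := by
  have h0 : ∀ C ∈ F, ∀ v ∈ C, v ≠ 0 := fun C hC v hv =>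
    norm_pos_iff.1 (hc.trans_le (hF C hC v hv))
  have hne : ∀ v, v ≠ 0 → g v ≠ g (-v) := fun v hv hgv => by
    have := h v (-v) hv (neg_ne_zero.2 hv) hgv
    rw [norm_neg, smul_neg, add_neg_cancel, norm_zero] at this
    linarith
  have hnc : ∀ C ∈ F, ∀ l : List E, (∀ x ∈ l, x ∈ C) →
      (∀ x ∈ l, ∀ y ∈ l, dist x y ≤ m) → NoComplementary (l.map (antipodalLabel g)) := by
    intro C hC l hl hlm a ha b hb hab
    obtain ⟨v, hv, rfl⟩ := List.mem_map.1 ha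
    obtain ⟨w, hw, rfl⟩ := List.mem_map.1 hb
    by_contra hcon
    have key : ∀ v ∈ l, ∀ w ∈ l, g v ≠ g (-w) := by
      intro v hv w hw hvw
      have h1 := h v (-w) (h0 C hC v (hl v hv)) (neg_ne_zero.2 (h0 C hC w (hl w hw))) hvw
      rw [norm_neg, smul_neg, ← sub_eq_add_neg] at h1
      have h2 := norm_normalize_sub_le hc (hF C hC v (hl v hv)) (hF C hC w (hl w hw))
      have h3 := hlm v hv w hw
      rw [dist_eq_norm] at h3
      have : 2 / c * ‖v - w‖ ≤ 2 / c * m := by gcongr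
      linarith
    rcases eq_neg_of_antipodalLabel hab hcon with h | h
    · exact key v hv w hw h
    · exact key w hw v hv h
  refine ⟨rfl, fun C hC l _ hlC hlm => ?_, fun C hC l hl hlC hlm => ?_⟩
  · rw [cobd_map, cobd_sortedAlternating (hnc C hC l hlC hlm), List.map_map, List.map_map]
    congr 2
    refine List.map_congr_left fun v hv => ?_
    exact (antipodalLabel_neg (hne v (h0 C hC v (hlC v hv)))).symm
  · refine sortedAlternating_eq_zero (hnc C hC l hlC hlm) (d := d) ?_ (by simp [hl])
    intro a ha
    obtain ⟨v, hv, rfl⟩ := List.mem_map.1 ha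
    exact antipodalLabel_lt (hne v (h0 C hC v (hlC v hv))) (hg _) (hg _)

/-- The affine hyperplanes spanned by the faces of the cross-polytope (and some more). -/
def octFaces (d : ℕ) : Set (Set (EuclideanSpace ℝ (Fin (d + 1)))) :=
  {C | ∃ s : Fin (d + 1) → ℝ, (∀ i, |s i| ≤ 1) ∧ C = {v | ∑ i, s i * v i = 1}}

theorem octFaces_convex {d : ℕ} : ∀ C ∈ octFaces d, Convex ℝ C := by
  rintro _ ⟨s, -, rfl⟩ v hv w hw a b - - hab
  simp only [Set.mem_ofPred_eq, PiLp.add_apply, PiLp.smul_apply, smul_eq_mul] at *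
  calc _ = a * ∑ i, s i * v i + b * ∑ i, s i * w i := by
        rw [Finset.mul_sum, Finset.mul_sum, ← Finset.sum_add_distrib]
        exact Finset.sum_congr rfl fun i _ => by ring
    _ = 1 := by rw [hv, hw]; linarith

theorem octFaces_norm {d : ℕ} : ∀ C ∈ octFaces d, ∀ v ∈ C, 1 / ((d : ℝ) + 1) ≤ ‖v‖ := by
  rintro _ ⟨s, hs, rfl⟩ v hv
  rw [div_le_iff₀ (by positivity)]
  calc (1 : ℝ) = ∑ i, s i * v i := hv.symm
    _ ≤ ∑ i : Fin (d + 1), ‖v‖ := Finset.sum_le_sum fun i _ => by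
        calc s i * v i ≤ |s i * v i| := le_abs_self _
          _ = |s i| * ‖v i‖ := by rw [abs_mul, Real.norm_eq_abs]
          _ ≤ 1 * ‖v‖ := by
            gcongr
            · exact hs i
            · exact PiLp.norm_apply_le v i
          _ = ‖v‖ := one_mul _
    _ = _ := by simp [mul_comm]

theorem exists_octFace {d : ℕ} {I : List (Fin (d + 1))} (hI : I.Nodup)
    {l : List (EuclideanSpace ℝ (Fin (d + 1)))}
    (hl : List.Forall₂ (fun x e => x = e ∨ x = -e) l
      (I.map fun i => EuclideanSpace.single i (1 : ℝ))) :
    ∃ s : Fin (d + 1) → ℝ, (∀ i, |s i| ≤ 1) ∧ ∀ x ∈ l, ∑ i, s i * x i = 1 := by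
  have hsupp : ∀ (J : List (Fin (d + 1))) (u : List (EuclideanSpace ℝ (Fin (d + 1)))),
      List.Forall₂ (fun x e => x = e ∨ x = -e) u
        (J.map fun i => EuclideanSpace.single i (1 : ℝ)) →
      ∀ x ∈ u, ∀ i, i ∉ J → x i = 0 := by
    intro J
    induction J with
    | nil => intro u hu; simp at hu; simp [hu]
    | cons j J ih =>
      intro u hu x hx i hi
      rw [List.map_cons] at hu
      cases hu with
      | cons h1 h2 =>
        simp only [List.mem_cons, not_or] at hi hx
        rcases hx with rfl | hx
        · rcases h1 with rfl | rfl <;> simp [hi.1]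
        · exact ih _ h2 x hx i hi.2
  induction I generalizing l with
  | nil => simp at hl; exact ⟨0, by simp, by simp [hl]⟩
  | cons j I ih =>
    rw [List.nodup_cons] at hI
    rw [List.map_cons] at hl
    cases hl with
    | @cons x _ u _ h1 h2 =>
      obtain ⟨s, hs, hsu⟩ := ih hI.2 h2
      -- The new coefficient is the sign of the new vertex; the other vertices have vanishing `j`-th
      -- coordinate.
      refine ⟨Function.update s j (x j), fun i => ?_, fun y hy => ?_⟩
      · by_cases hij : i = j
        · subst hij
          rcases h1 with rfl | rfl <;> simp
        · simpa [hij] using hs i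
      · rcases List.mem_cons.1 hy with rfl | hy
        · rw [Finset.sum_eq_single j]
          · rcases h1 with rfl | rfl <;> simp
          · intro i _ hij
            rcases h1 with rfl | rfl <;> simp [hij]
          · simp
        · rw [← hsu y hy]
          refine Finset.sum_congr rfl fun i _ => ?_
          by_cases hij : i = j
          · subst hij
            simp [hsupp I u h2 y hy i hI.1]
          · simp [hij]

theorem octSum_eq_one {d : ℕ} {β : List (EuclideanSpace ℝ (Fin (d + 1))) → ZMod 2}
    (hβ : IsAntipodalCochain (octFaces d) (d + 1) 2 β) {I : List (Fin (d + 1))} (hI : I.Nodup) :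
    octSum (I.map fun i => EuclideanSpace.single i (1 : ℝ)) β = 1 ∧
      ∀ l, List.Forall₂ (fun x e => x = e ∨ x = -e) l
      (I.map fun i => EuclideanSpace.single i (1 : ℝ)) → l.length = d + 1 → β l = 0 := by
  have hnorm : ∀ (J : List (Fin (d + 1))) (u : List (EuclideanSpace ℝ (Fin (d + 1)))),
      List.Forall₂ (fun x e => x = e ∨ x = -e) u
        (J.map fun i => EuclideanSpace.single i (1 : ℝ)) → ∀ x ∈ u, ‖x‖ ≤ 1 := by
    intro J
    induction J with
    | nil => intro u hu; simp at hu; simp [hu]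
    | cons j J ih =>
      intro u hu x hx
      rw [List.map_cons] at hu
      cases hu with
      | cons h1 h2 =>
        rcases List.mem_cons.1 hx with rfl | hx
        · rcases h1 with rfl | rfl <;> simp
        · exact ih _ h2 x hx
  have hdist : ∀ (J : List (Fin (d + 1))) (u : List (EuclideanSpace ℝ (Fin (d + 1)))),
      List.Forall₂ (fun x e => x = e ∨ x = -e) u
        (J.map fun i => EuclideanSpace.single i (1 : ℝ)) →
        ∀ x ∈ u, ∀ y ∈ u, dist x y ≤ 2 := by
    intro J u hu x hx y hy
    rw [dist_eq_norm]
    linarith [norm_sub_le x y, hnorm J u hu x hx, hnorm J u hu y hy]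
  constructor
  · induction I with
    | nil => exact hβ.nil
    | cons j I ih =>
      rw [List.map_cons, octSum_cons, ih hI.of_cons]
      intro l hl
      have hl' : List.Forall₂ (fun x e => x = e ∨ x = -e) (EuclideanSpace.single j (1 : ℝ) :: l)
          ((j :: I).map fun i => EuclideanSpace.single i (1 : ℝ)) := .cons (.inl rfl) hl
      obtain ⟨s, hs, hsl⟩ := exists_octFace hI hl'
      refine hβ.cobd_eq _ ⟨s, hs, rfl⟩ _ ?_ hsl (hdist _ _ hl')
      rw [hl'.length_eq, List.length_map]
      simpa using hI.length_le_card
  · intro l hl hlen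
    obtain ⟨s, hs, hsl⟩ := exists_octFace hI hl
    exact hβ.eq_zero _ ⟨s, hs, rfl⟩ l hlen hsl (hdist _ _ hl)

/-- A form of the Lusternik–Schnirelmann theorem for arbitrary colourings of the sphere: with
`d + 1` colours, some colour occurs near two antipodal points. -/
theorem exists_near_antipodal {d : ℕ} (f : UnitSphere d → Fin (d + 1)) {δ : ℝ} (hδ : 0 < δ) :
    ∃ x y : UnitSphere d, f x = f y ∧ ‖(x : EuclideanSpace ℝ (Fin (d + 1))) + y‖ < δ := by
  by_contra! H
  have hmem : ∀ v : EuclideanSpace ℝ (Fin (d + 1)), v ≠ 0 →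
      ‖v‖⁻¹ • v ∈ Metric.sphere (0 : EuclideanSpace ℝ (Fin (d + 1))) 1 := fun v hv => by
    rw [mem_sphere_zero_iff_norm, norm_smul, norm_inv, norm_norm,
      inv_mul_cancel₀ (norm_ne_zero_iff.2 hv)]
  classical
  let g : EuclideanSpace ℝ (Fin (d + 1)) → ℕ := fun v =>
    -- The value at the origin is irrelevant, since the sets in `octFaces d` stay away from it.
    if hv : v ≠ 0 then (f ⟨‖v‖⁻¹ • v, hmem v hv⟩ : ℕ) else 0
  have hg : ∀ v, g v < d + 1 := by
    intro v
    simp only [g]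
    split_ifs
    · exact (f _).2
    · exact Nat.succ_pos d
  have hgδ : ∀ v w, v ≠ 0 → w ≠ 0 → g v = g w → δ ≤ ‖‖v‖⁻¹ • v + ‖w‖⁻¹ • w‖ := by
    intro v w hv hw hvw
    simp only [g, dif_pos hv, dif_pos hw] at hvw
    exact H ⟨‖v‖⁻¹ • v, hmem v hv⟩ ⟨‖w‖⁻¹ • w, hmem w hw⟩ (Fin.ext hvw)
  have hc : (0 : ℝ) < 1 / ((d : ℝ) + 1) := by positivity
  obtain ⟨m, hm0, hm⟩ : ∃ m : ℝ, 0 < m ∧ 2 / (1 / ((d : ℝ) + 1)) * m < δ :=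
    ⟨δ / (2 / (1 / ((d : ℝ) + 1))) / 2, by positivity, by field_simp; norm_num⟩
  obtain ⟨β, hβ⟩ := (isAntipodalCochain_antipodalLabel hc (octFaces_norm (d := d)) hg hδ hgδ
    hm).exists_of_pos octFaces_convex (by omega) (M := 2) (by norm_num) hm0
  obtain ⟨h1, h2⟩ := octSum_eq_one hβ (List.nodup_finRange (d + 1))
  have h0 : ∀ es : List (EuclideanSpace ℝ (Fin (d + 1))), octSum es (fun _ => 0) = 0 := fun es => by
    simpa using octSum_add es (fun _ => 0) (fun _ => 0)
  rw [octSum_congr (β := fun _ => 0) fun l hl => h2 l hl ?_, h0] at h1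
  · exact zero_ne_one h1
  · rw [hl.length_eq, List.length_map, List.length_finRange]

end LusternikSchnirelmann

/-! ### From the sphere to the graph: the lower bound. -/

/-- If the points are dense enough in the sphere, the Borsuk graph needs `d + 2` colours. -/
theorem borsukGraph_not_colorable {d n : ℕ} {ε ε₀ a : ℝ} {x : Fin n → UnitSphere d}
    (hε : ε₀ ≤ ε) (hε₀ : ε₀ ≤ 2) (haε : 4 * a ^ 2 < 4 * ε₀ - ε₀ ^ 2)
    (hx : ∀ y, ∃ i, dist y (x i) ≤ a) : ¬ (borsukGraph ε x).Colorable (d + 1) := by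
  rintro ⟨c⟩
  choose i hi using hx
  obtain ⟨δ, hδ, hδa⟩ : ∃ δ : ℝ, 0 < δ ∧ (2 * a + δ) ^ 2 < 4 * ε₀ - ε₀ ^ 2 := by
    have h : Tendsto (fun δ : ℝ => (2 * a + δ) ^ 2) (𝓝[>] 0) (𝓝 ((2 * a + 0) ^ 2)) := by
      apply Tendsto.mono_left _ nhdsWithin_le_nhds
      exact Continuous.tendsto (by fun_prop) 0
    have h2 := (h.eventually_lt_const (u := 4 * ε₀ - ε₀ ^ 2) (by nlinarith)).and
      self_mem_nhdsWithin
    obtain ⟨δ, h3, h4⟩ := h2.exists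
    exact ⟨δ, h4, h3⟩
  obtain ⟨y, z, hyz, hlt⟩ := exists_near_antipodal (fun y => c (i y)) hδ
  refine c.valid (v := i y) (w := i z) ?_ hyz
  have hd : 2 - ε₀ < dist (x (i y)) (x (i z)) := by
    have hy := hi y
    have hz := hi z
    rw [Subtype.dist_eq, dist_eq_norm] at hy hz ⊢
    generalize x (i y) = p at *
    generalize x (i z) = q at *
    have h1 : ‖(p : EuclideanSpace ℝ (Fin (d + 1))) + q‖ < 2 * a + δ := by
      have : (p : EuclideanSpace ℝ (Fin (d + 1))) + q = (y + z) - (y - p) - (z - q) := by abel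
      rw [this]
      have h3 := norm_sub_le ((y + z : EuclideanSpace ℝ (Fin (d + 1))) - (y - p)) (z - q)
      have h4 := norm_sub_le (y + z : EuclideanSpace ℝ (Fin (d + 1))) (y - p)
      linarith
    have h2 := parallelogram_law_with_norm ℝ (p : EuclideanSpace ℝ (Fin (d + 1))) q
    have hp : ‖(p : EuclideanSpace ℝ (Fin (d + 1)))‖ = 1 := norm_eq_of_mem_sphere p
    have hq : ‖(q : EuclideanSpace ℝ (Fin (d + 1)))‖ = 1 := norm_eq_of_mem_sphere q
    rw [hp, hq] at h2
    have h3 : ‖(p : EuclideanSpace ℝ (Fin (d + 1))) + q‖ ^ 2 < 4 * ε₀ - ε₀ ^ 2 :=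
      lt_trans (by gcongr) hδa
    refine lt_of_pow_lt_pow_left₀ 2 (norm_nonneg _) ?_
    nlinarith
  refine ⟨fun h => ?_, by linarith⟩
  rw [h, dist_self] at hd
  linarith

/-! ### The regular simplex and the upper bound. -/

section RegularSimplex

variable {d : ℕ} {Δ : Affine.Simplex ℝ (EuclideanSpace ℝ (Fin (d + 1))) (d + 1)}

theorem IsRegularInscribed.exists_inner_eq (hΔ : IsRegularInscribed Δ) :
    ∃ g : ℝ, g ≠ 1 ∧ ∀ i j, i ≠ j → inner ℝ (Δ.points i) (Δ.points j) = g := by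
  obtain ⟨r, hr⟩ := hΔ.equilateral
  have h : ∀ i j, i ≠ j → inner ℝ (Δ.points i) (Δ.points j) = 1 - r ^ 2 / 2 := fun i j hij => by
    have := norm_sub_sq_real (Δ.points i) (Δ.points j)
    rw [← dist_eq_norm, hr i j hij, hΔ.norm_eq_one, hΔ.norm_eq_one] at this
    linarith
  refine ⟨_, fun h1 => ?_, h⟩
  have h01 : (0 : Fin (d + 2)) ≠ 1 := by simp
  have h2 : r ≠ 0 := by
    rw [← hr 0 1 h01, dist_ne_zero]
    exact fun h => h01 (Δ.independent.injective h)
  have : 0 < r ^ 2 := by positivity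
  linarith

theorem exists_sum_smul_points (Δ : Affine.Simplex ℝ (EuclideanSpace ℝ (Fin (d + 1))) (d + 1))
    (x : EuclideanSpace ℝ (Fin (d + 1))) :
    ∃ c : Fin (d + 2) → ℝ, ∑ i, c i = 1 ∧ ∑ i, c i • Δ.points i = x := by
  let b : AffineBasis (Fin (d + 2)) ℝ (EuclideanSpace ℝ (Fin (d + 1))) :=
    ⟨Δ.points, Δ.independent, by
      rw [Δ.independent.affineSpan_eq_top_iff_card_eq_finrank_add_one]; simp⟩
  exact ⟨fun i => b.coord i x, b.sum_coord_apply_eq_one x, b.linear_combination_coord_eq_self x⟩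

/-- Pairing with each vertex shows that the barycentric coordinates of the origin are all equal. -/
theorem IsRegularInscribed.sum_points (hΔ : IsRegularInscribed Δ) : ∑ i, Δ.points i = 0 := by
  obtain ⟨g, hg, hin⟩ := hΔ.exists_inner_eq
  obtain ⟨c, hc1, hc0⟩ := exists_sum_smul_points Δ 0
  have hc : ∀ j, c j = -g / (1 - g) := fun j => by
    have h := congrArg (fun v => inner ℝ v (Δ.points j)) hc0
    simp only [sum_inner, inner_smul_left, inner_zero_left, conj_trivial] at h
    have h1 : ∀ i, c i * inner ℝ (Δ.points i) (Δ.points j) =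
        c i * g + if i = j then c i * (1 - g) else 0 := fun i => by
      split_ifs with hij
      · rw [hij, real_inner_self_eq_norm_sq, hΔ.norm_eq_one]; ring
      · rw [hin i j hij]; ring
    simp only [h1, Finset.sum_add_distrib, ← Finset.sum_mul, hc1, Finset.sum_ite_eq',
      Finset.mem_univ, if_true] at h
    rw [eq_div_iff (sub_ne_zero.2 hg.symm)]
    linarith
  simp only [hc, ← Finset.smul_sum] at hc0
  refine (smul_eq_zero.1 hc0).resolve_left fun h => ?_
  simp only [hc, h, Finset.sum_const_zero] at hc1
  exact zero_ne_one hc1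

/-- The radial projection of the facet opposite to the vertex `i`. -/
def facetProj (Δ : Affine.Simplex ℝ (EuclideanSpace ℝ (Fin (d + 1))) (d + 1)) (i : Fin (d + 2)) :
    Set (EuclideanSpace ℝ (Fin (d + 1))) :=
  (fun x => ‖x‖⁻¹ • x) '' convexHull ℝ (Δ.points '' {i}ᶜ)

theorem facetProjDiam_eq (i : Fin (d + 2)) : facetProjDiam Δ i = Metric.diam (facetProj Δ i) := by
  rw [facetProjDiam, facetProj, ← Affine.Simplex.convexHull_eq_closedInterior,
    Affine.Simplex.range_faceOpposite_points]

theorem IsRegularInscribed.exists_mem_facetProj (hΔ : IsRegularInscribed Δ)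
    {x : EuclideanSpace ℝ (Fin (d + 1))} (hx : ‖x‖ = 1) : ∃ i, x ∈ facetProj Δ i := by
  obtain ⟨c, -, hcx⟩ := exists_sum_smul_points Δ x
  obtain ⟨i, hi⟩ := Finite.exists_min c
  -- As the vertices sum to zero, subtracting the least coefficient changes nothing; it leaves a
  -- nonnegative combination without vertex `i`.
  have hw : ∑ k, (c k - c i) • Δ.points k = x := by
    simp only [sub_smul, Finset.sum_sub_distrib, hcx, ← Finset.smul_sum, hΔ.sum_points, smul_zero,
      sub_zero]
  have hw0 : ∀ k, 0 ≤ c k - c i := fun k => sub_nonneg.2 (hi k)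
  have hsum : ∑ k ∈ Finset.univ.erase i, (c k - c i) • Δ.points k = x := by
    rw [← hw, Finset.sum_erase]
    simp
  have hpos : 0 < ∑ k ∈ Finset.univ.erase i, (c k - c i) := by
    refine (Finset.sum_nonneg fun k _ => hw0 k).lt_of_ne fun h => ?_
    have h1 := (Finset.sum_eq_zero_iff_of_nonneg fun k _ => hw0 k).1 h.symm
    rw [Finset.sum_eq_zero fun k hk => by rw [h1 k hk, zero_smul]] at hsum
    rw [← hsum, norm_zero] at hx
    exact zero_ne_one hx
  have hmem := Finset.centerMass_mem_convexHull (R := ℝ) (Finset.univ.erase i)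
    (w := fun k => c k - c i) (z := Δ.points) (s := Δ.points '' {i}ᶜ) (fun k _ => hw0 k) hpos
    fun k hk => ⟨k, Finset.ne_of_mem_erase hk, rfl⟩
  refine ⟨i, _, hmem, ?_⟩
  rw [Finset.centerMass, hsum]
  simp only [norm_smul, hx, norm_inv, mul_one, inv_inv, Real.norm_of_nonneg hpos.le]
  rw [smul_inv_smul₀ hpos.ne']

theorem facetProj_subset (i : Fin (d + 2)) : facetProj Δ i ⊆ Metric.closedBall 0 1 := by
  rintro _ ⟨x, -, rfl⟩
  rw [mem_closedBall_zero_iff, norm_smul, norm_inv, norm_norm]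
  exact inv_mul_le_one

theorem IsRegularInscribed.dist_le (hΔ : IsRegularInscribed Δ) (τ i : Fin (d + 2))
    {x y : EuclideanSpace ℝ (Fin (d + 1))} (hx : x ∈ facetProj Δ i) (hy : y ∈ facetProj Δ i) :
    dist x y ≤ facetProjDiam Δ τ := by
  obtain ⟨g, -, hin⟩ := hΔ.exists_inner_eq
  -- This reflection exchanges the vertices `i` and `τ` and fixes the others, so it maps one facet
  -- onto the other.
  let T := (ℝ ∙ (Δ.points i - Δ.points τ))ᗮ.reflection
  have hT : ∀ k, ∃ j, T (Δ.points k) = Δ.points j ∧ (k ≠ i → j ≠ τ) := by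
    intro k
    have hn : ∀ a b, ‖Δ.points a‖ = ‖Δ.points b‖ := fun a b => by
      rw [hΔ.norm_eq_one, hΔ.norm_eq_one]
    by_cases hki : k = i
    · subst hki
      exact ⟨τ, Submodule.reflection_sub (hn _ _), fun h => absurd rfl h⟩
    by_cases hkτ : k = τ
    · subst hkτ
      refine ⟨i, ?_, fun h => h.symm⟩
      have := Submodule.reflection_sub (hn i k)
      rw [← this]
      exact Submodule.reflection_reflection _ _
    · refine ⟨k, Submodule.reflection_mem_subspace_eq_self ?_, fun _ => hkτ⟩
      rw [Submodule.mem_orthogonal_singleton_iff_inner_left, inner_sub_right, hin k i hki,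
        hin k τ hkτ, sub_self]
  have hmap : ∀ x ∈ facetProj Δ i, T x ∈ facetProj Δ τ := by
    rintro _ ⟨x, hx, rfl⟩
    refine ⟨T x, ?_, by simp⟩
    have h1 : T x ∈ T.toLinearEquiv.toLinearMap '' convexHull ℝ (Δ.points '' {i}ᶜ) := ⟨x, hx, rfl⟩
    rw [LinearMap.image_convexHull] at h1
    refine convexHull_mono ?_ h1
    rintro _ ⟨_, ⟨k, hk, rfl⟩, rfl⟩
    obtain ⟨j, hj, hjτ⟩ := hT k
    exact ⟨j, hjτ hk, hj.symm⟩
  rw [facetProjDiam_eq, ← T.dist_map]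
  exact Metric.dist_le_diam_of_mem (Metric.isBounded_closedBall.subset (facetProj_subset τ))
    (hmap x hx) (hmap y hy)

theorem IsRegularInscribed.borsukGraph_colorable (hΔ : IsRegularInscribed Δ) (τ : Fin (d + 2))
    {ε : ℝ} (hε : ε ≤ 2 - facetProjDiam Δ τ) {n : ℕ} (x : Fin n → UnitSphere d) :
    (borsukGraph ε x).Colorable (d + 2) := by
  choose c hc using fun y : UnitSphere d => hΔ.exists_mem_facetProj (norm_eq_of_mem_sphere y)
  refine ⟨SimpleGraph.Coloring.mk (fun i => c (x i)) fun {i j} hij heq => ?_⟩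
  have h1 := hij.2
  have h2 := hΔ.dist_le τ (c (x i)) (hc (x i)) (heq ▸ hc (x j))
  rw [Subtype.dist_eq] at h1
  linarith

end RegularSimplex

/-! ### Packing, caps and the union bound. -/

section SphereMeasure

variable {d : ℕ}

theorem pow_sub_pow_le_mul_pow {a b : ℝ} (hb : 0 ≤ b) (hab : b ≤ a) (n : ℕ) :
    a ^ (n + 1) - b ^ (n + 1) ≤ (n + 1) * a ^ n * (a - b) := by
  induction n with
  | zero => simp
  | succ n ih =>
    have h1 : a * (a ^ (n + 1) - b ^ (n + 1)) ≤ a * ((n + 1) * a ^ n * (a - b)) :=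
      mul_le_mul_of_nonneg_left ih (hb.trans hab)
    have h2 : b ^ (n + 1) * (a - b) ≤ a ^ (n + 1) * (a - b) :=
      mul_le_mul_of_nonneg_right (pow_le_pow_left₀ hb hab _) (sub_nonneg.2 hab)
    push_cast
    linear_combination h1 + h2

/-- Disjoint balls of radius `h` around the points fit into the shell between the radii `1 - h` and
`1 + h`; volumes are compared. -/
theorem card_mul_pow_le_of_separated {h : ℝ} (h0 : 0 < h) (h1 : h ≤ 1)
    (T : Finset (UnitSphere d)) (hT : ∀ s ∈ T, ∀ t ∈ T, s ≠ t → 2 * h ≤ dist s t) :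
    (T.card : ℝ) * h ^ d ≤ 2 * (d + 1) * (1 + h) ^ d := by
  let E := EuclideanSpace ℝ (Fin (d + 1))
  let μ : Measure E := volume
  have hball : ∀ (x : E) {r : ℝ}, 0 ≤ r → μ.real (Metric.ball x r) =
      r ^ (d + 1) * μ.real (Metric.ball 0 1) := fun x r hr => by
    rw [measureReal_def, Measure.addHaar_ball μ x hr, ENNReal.toReal_mul,
      ENNReal.toReal_ofReal (by positivity), measureReal_def]
    simp [E]
  have hV : 0 < μ.real (Metric.ball (0 : E) 1) :=
    ENNReal.toReal_pos (Metric.measure_ball_pos _ _ one_pos).ne' measure_ball_lt_top.ne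
  have hdisj : (T : Set (UnitSphere d)).PairwiseDisjoint fun t => Metric.ball (t : E) h := by
    intro s hs t ht hst
    refine Metric.ball_disjoint_ball ?_
    have := hT s hs t ht hst
    rw [Subtype.dist_eq] at this
    linarith
  have hunion : μ.real (⋃ t ∈ T, Metric.ball (t : E) h) =
      T.card * (h ^ (d + 1) * μ.real (Metric.ball 0 1)) := by
    rw [measureReal_biUnion_finset hdisj (fun _ _ => Metric.isOpen_ball.measurableSet)
      fun _ _ => measure_ball_lt_top.ne]
    simp only [hball _ h0.le, Finset.sum_const, nsmul_eq_mul]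
  have hsub : (⋃ t ∈ T, Metric.ball (t : E) h) ⊆
      Metric.ball 0 (1 + h) \ Metric.ball 0 (1 - h) := by
    refine Set.iUnion₂_subset fun t _ x hx => ?_
    have ht : ‖(t : E)‖ = 1 := norm_eq_of_mem_sphere t
    rw [Metric.mem_ball, dist_eq_norm] at hx
    rw [Set.mem_sdiff, mem_ball_zero_iff, mem_ball_zero_iff, not_lt]
    constructor
    · linarith [norm_sub_norm_le x (t : E)]
    · have := norm_sub_norm_le (t : E) x
      rw [norm_sub_rev] at this
      linarith
  have hmono := measureReal_mono hsub (h₂ := (measure_mono Set.sdiff_subset).trans_lt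
    (measure_ball_lt_top (μ := μ)) |>.ne)
  rw [hunion, measureReal_sdiff (Metric.ball_subset_ball (by linarith))
    Metric.isOpen_ball.measurableSet, hball 0 (r := 1 + h) (by linarith), hball 0 (r := 1 - h) (by linarith), ← sub_mul,
    ← mul_assoc] at hmono
  have h3 := le_of_mul_le_mul_right hmono hV
  have h4 := h3.trans (pow_sub_pow_le_mul_pow (a := 1 + h) (b := 1 - h) (by linarith) (by linarith) d)
  refine le_of_mul_le_mul_right (a := h) ?_ h0
  calc _ = (T.card : ℝ) * h ^ (d + 1) := by ring
    _ ≤ _ := h4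
    _ = _ := by ring

/-- The sphere has economical nets. -/
theorem exists_sphere_net {h : ℝ} (h0 : 0 < h) (h1 : h ≤ 1) :
    ∃ T : Finset (UnitSphere d), (∀ x, ∃ t ∈ T, dist x t < 2 * h) ∧
      (T.card : ℝ) * h ^ d ≤ 2 * (d + 1) * (1 + h) ^ d := by
  classical
  let S : Set ℕ := {k | ∃ T : Finset (UnitSphere d),
    (∀ s ∈ T, ∀ t ∈ T, s ≠ t → 2 * h ≤ dist s t) ∧ T.card = k}
  have hS : S.Nonempty := ⟨0, ∅, by simp, rfl⟩
  have hbdd : BddAbove S := by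
    refine ⟨⌊2 * (d + 1) * (1 + h) ^ d / h ^ d⌋₊, ?_⟩
    rintro _ ⟨T, hT, rfl⟩
    refine Nat.le_floor ?_
    rw [le_div_iff₀ (by positivity)]
    exact card_mul_pow_le_of_separated h0 h1 T hT
  obtain ⟨T, hT, hcard⟩ := Nat.sSup_mem hS hbdd
  refine ⟨T, fun x => ?_, card_mul_pow_le_of_separated h0 h1 T hT⟩
  by_contra! hx
  have hxT : x ∉ T := fun hxT => by
    have := hx x hxT
    rw [dist_self] at this
    linarith
  have h2 : T.card + 1 ∈ S := by
    refine ⟨insert x T, fun s hs t ht hst => ?_, Finset.card_insert_of_notMem hxT⟩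
    rw [Finset.mem_insert] at hs ht
    rcases hs with rfl | hs <;> rcases ht with rfl | ht
    · exact absurd rfl hst
    · exact hx t ht
    · rw [dist_comm]; exact hx s hs
    · exact hT s hs t ht hst
  have := le_csSup hbdd h2
  omega

open scoped Pointwise in
theorem uniformSphere_ball_eq (x y : UnitSphere d) (r : ℝ) :
    uniformSphere d (Metric.ball x r) = uniformSphere d (Metric.ball y r) := by
  let E := EuclideanSpace ℝ (Fin (d + 1))
  let T : E ≃ₗᵢ[ℝ] E := (ℝ ∙ ((x : E) - y))ᗮ.reflection
  have hnorm : ‖(x : E)‖ = ‖(y : E)‖ := by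
    rw [norm_eq_of_mem_sphere x, norm_eq_of_mem_sphere y]
  have hTx : T x = y := Submodule.reflection_sub hnorm
  have hTT : ∀ z, T (T z) = z := Submodule.reflection_reflection _
  have hTy : T y = x := by rw [← hTx, hTT]
  have hT : ∀ (a b : UnitSphere d), T a = b → ∀ z : E,
      z ∈ Set.Ioo (0 : ℝ) 1 • ((↑) '' Metric.ball a r : Set E) →
      T z ∈ Set.Ioo (0 : ℝ) 1 • ((↑) '' Metric.ball b r : Set E) := by
    rintro a b hab _ ⟨c, hc, _, ⟨u, hu, rfl⟩, rfl⟩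
    refine ⟨c, hc, T u, ⟨⟨T u, ?_⟩, ?_, rfl⟩, (T.map_smul c u).symm⟩
    · rw [mem_sphere_zero_iff_norm, T.norm_map, norm_eq_of_mem_sphere u]
    · rw [Metric.mem_ball, Subtype.dist_eq] at hu ⊢
      rw [← hab]
      exact (T.dist_map _ _).trans_lt hu
  have hpre : T ⁻¹' (Set.Ioo (0 : ℝ) 1 • ((↑) '' Metric.ball y r : Set E)) =
      Set.Ioo (0 : ℝ) 1 • ((↑) '' Metric.ball x r : Set E) := by
    ext z
    refine ⟨fun hz => ?_, hT x y hTx z⟩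
    rw [← hTT z]
    exact hT y x hTy _ hz
  rw [uniformSphere, Measure.smul_apply, Measure.smul_apply,
    Measure.toSphere_apply' _ Metric.isOpen_ball.measurableSet,
    Measure.toSphere_apply' _ Metric.isOpen_ball.measurableSet, ← hpre]
  congr 2
  exact T.measurePreserving.measure_preimage_emb T.toHomeomorph.measurableEmbedding _

/-- The balls around a net cover the sphere and have equal measure, so each has at least the
reciprocal of the size of the net. -/
theorem le_uniformSphere_ball {h : ℝ} (h0 : 0 < h) (h1 : h ≤ 1) (x : UnitSphere d) :
    h ^ d / (2 * (d + 1) * (1 + h) ^ d) ≤ (uniformSphere d).real (Metric.ball x (2 * h)) := by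
  obtain ⟨T, hT, hcard⟩ := exists_sphere_net (d := d) h0 h1
  have hcov : (Set.univ : Set (UnitSphere d)) ⊆ ⋃ t ∈ T, Metric.ball t (2 * h) := fun y _ => by
    obtain ⟨t, ht, hyt⟩ := hT y
    exact Set.mem_iUnion₂.2 ⟨t, ht, hyt⟩
  have h2 := (measureReal_mono hcov (measure_ne_top _ _)).trans
    (measureReal_biUnion_finset_le (μ := uniformSphere d) T fun t => Metric.ball t (2 * h))
  have h3 : ∀ t, (uniformSphere d).real (Metric.ball t (2 * h)) =
      (uniformSphere d).real (Metric.ball x (2 * h)) := fun t => by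
    rw [measureReal_def, measureReal_def, uniformSphere_ball_eq t x]
  simp only [h3, Finset.sum_const, nsmul_eq_mul, probReal_univ] at h2
  rw [div_le_iff₀ (by positivity)]
  calc h ^ d = 1 * h ^ d := (one_mul _).symm
    _ ≤ (T.card * (uniformSphere d).real (Metric.ball x (2 * h))) * h ^ d := by gcongr
    _ = (uniformSphere d).real (Metric.ball x (2 * h)) * (T.card * h ^ d) := by ring
    _ ≤ _ := by gcongr

/-- A union bound for the event that some ball around a point of `T` contains no sample point. -/
theorem measureReal_exists_ball_empty_le {Ω : Type*} [MeasurableSpace Ω] {P : Measure Ω}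
    [IsProbabilityMeasure P] {n : ℕ} {X : Fin n → Ω → UnitSphere d} (hindep : iIndepFun X P)
    (hunif : ∀ i, HasLaw (X i) (uniformSphere d) P) (T : Finset (UnitSphere d)) {r m : ℝ}
    (hm : ∀ t, m ≤ (uniformSphere d).real (Metric.ball t r)) :
    P.real {ω | ∃ t ∈ T, ∀ i, X i ω ∉ Metric.ball t r} ≤ T.card * Real.exp (-(n * m)) := by
  have hset : {ω | ∃ t ∈ T, ∀ i, X i ω ∉ Metric.ball t r} =
      ⋃ t ∈ T, ⋂ i ∈ (Finset.univ : Finset (Fin n)), X i ⁻¹' (Metric.ball t r)ᶜ := by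
    ext ω
    simp
  rw [hset]
  refine (measureReal_biUnion_finset_le _ _).trans ?_
  rw [← nsmul_eq_mul]
  refine Finset.sum_le_card_nsmul _ _ _ fun t _ => ?_
  have hmeas : MeasurableSet (Metric.ball t r)ᶜ := Metric.isOpen_ball.measurableSet.compl
  rw [measureReal_def, hindep.measure_inter_preimage_eq_mul _ (fun _ _ => hmeas),
    ENNReal.toReal_prod]
  have h1 : ∀ i, (P (X i ⁻¹' (Metric.ball t r)ᶜ)).toReal ≤ Real.exp (-m) := fun i => by
    have h2 := (hunif i).measureReal_eq (p := fun x => x ∈ (Metric.ball t r)ᶜ) hmeas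
    calc _ = (uniformSphere d).real (Metric.ball t r)ᶜ := h2
      _ = 1 - (uniformSphere d).real (Metric.ball t r) :=
        probReal_compl_eq_one_sub Metric.isOpen_ball.measurableSet
      _ ≤ -m + 1 := by linarith [hm t]
      _ ≤ _ := Real.add_one_le_exp _
  calc _ ≤ ∏ _i : Fin n, Real.exp (-m) :=
        Finset.prod_le_prod (fun _ _ => ENNReal.toReal_nonneg) fun i _ => h1 i
    _ = _ := by
      rw [Finset.prod_const, Finset.card_univ, Fintype.card_fin, ← Real.exp_nat_mul]
      ring_nf

end SphereMeasure

/-! ### Choice of the radii at the threshold. -/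

section Threshold

theorem tendsto_log_div_natCast : Tendsto (fun n : ℕ => Real.log n / n) atTop (𝓝 0) :=
  Real.isLittleO_log_id_atTop.tendsto_div_nhds_zero.comp tendsto_natCast_atTop_atTop

/-- The covering radius that belongs to the threshold `K (log n / n) ^ (2 / d)`. -/
noncomputable def coverRadius (K : ℝ) (d n : ℕ) : ℝ :=
  √K * (Real.log n / n) ^ (1 / (d : ℝ))

theorem log_div_natCast_nonneg (n : ℕ) : 0 ≤ Real.log n / n :=
  div_nonneg (Real.log_natCast_nonneg n) n.cast_nonneg

theorem coverRadius_sq {K : ℝ} (hK : 0 ≤ K) (d n : ℕ) :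
    coverRadius K d n ^ 2 = K * (Real.log n / n) ^ (2 / (d : ℝ)) := by
  rw [coverRadius, mul_pow, Real.sq_sqrt hK, ← Real.rpow_mul_natCast (log_div_natCast_nonneg n)]
  congr 2
  push_cast
  ring

theorem coverRadius_pow (K : ℝ) {d : ℕ} (hd : 1 ≤ d) (n : ℕ) :
    coverRadius K d n ^ d = √K ^ d * (Real.log n / n) := by
  rw [coverRadius, mul_pow, ← Real.rpow_mul_natCast (log_div_natCast_nonneg n), one_div,
    inv_mul_cancel₀ (by positivity), Real.rpow_one]

theorem tendsto_coverRadius (K : ℝ) {d : ℕ} (hd : 1 ≤ d) :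
    Tendsto (coverRadius K d) atTop (𝓝 0) := by
  have hpos : 0 < 1 / (d : ℝ) := by positivity
  have h := (tendsto_log_div_natCast.rpow_const (p := 1 / (d : ℝ)) (.inr hpos.le)).const_mul (√K)
  rwa [Real.zero_rpow hpos.ne', mul_zero] at h

theorem two_pow_lt_sqrt_threshold_pow {d : ℕ} (hd : 1 ≤ d) :
    2 ^ (d + 1) * ((d : ℝ) + 1) < √((64 / 3 : ℝ) * (3 * Real.pi ^ 2 / 4) ^ (1 / (d : ℝ))) ^ d := by
  have hK : 0 ≤ (64 / 3 : ℝ) * (3 * Real.pi ^ 2 / 4) ^ (1 / (d : ℝ)) := by positivity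
  refine lt_of_pow_lt_pow_left₀ 2 (by positivity) ?_
  rw [← pow_mul, mul_comm d 2, pow_mul, Real.sq_sqrt hK, mul_pow (64 / 3 : ℝ),
    ← Real.rpow_mul_natCast (by positivity), one_div, inv_mul_cancel₀ (by positivity),
    Real.rpow_one]
  have h1 : ((d : ℝ) + 1) ≤ 2 ^ d := by
    exact_mod_cast Nat.lt_two_pow_self (n := d)
  have h2 : (4 / 3 : ℝ) ≤ (4 / 3) ^ d := le_self_pow₀ (by norm_num) (by omega)
  have h3 : (4 : ℝ) < Real.pi ^ 2 := by nlinarith [Real.pi_gt_three]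
  calc (2 ^ (d + 1) * ((d : ℝ) + 1)) ^ 2 ≤ (2 ^ (d + 1) * 2 ^ d) ^ 2 := by gcongr
    _ = (4 * 4 ^ d) * 4 ^ d := by
      rw [show (4 : ℝ) = 2 ^ 2 by norm_num, ← pow_mul]; ring
    _ = 16 ^ d * 4 := by rw [show (16 : ℝ) = 4 * 4 by norm_num, mul_pow]; ring
    _ < 16 ^ d * Real.pi ^ 2 := by gcongr
    _ = 16 ^ d * (4 / 3) * (3 * Real.pi ^ 2 / 4) := by ring
    _ ≤ 16 ^ d * (4 / 3) ^ d * (3 * Real.pi ^ 2 / 4) := by gcongr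
    _ = _ := by rw [← mul_pow]; norm_num

theorem exists_net_parameters {d : ℕ} (hd : 1 ≤ d) {K : ℝ} (hK : 0 < K)
    (hKd : 2 ^ (d + 1) * ((d : ℝ) + 1) < √K ^ d) :
    ∃ C : ℝ, ∀ᶠ n : ℕ in atTop, ∃ (T : Finset (UnitSphere d)) (r a m : ℝ),
      4 * a ^ 2 < 4 * coverRadius K d n ^ 2 - (coverRadius K d n ^ 2) ^ 2 ∧
      coverRadius K d n ^ 2 ≤ 2 ∧
      (∀ x, ∃ t ∈ T, dist x t + r ≤ a) ∧
      (∀ t, m ≤ (uniformSphere d).real (Metric.ball t r)) ∧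
      T.card * Real.exp (-(n * m)) ≤ C / Real.log n := by
  -- Of the three factors `θ ^ d`, two pay for the radius `θ ^ 2 * ρ` and one for the factor `(1 +
  -- h) ^ d` in the cap bound.
  obtain ⟨θ, ⟨hθ0, hθ1⟩, hθ⟩ : ∃ θ : ℝ, (0 < θ ∧ θ < 1) ∧
      2 ^ (d + 1) * ((d : ℝ) + 1) < θ ^ (3 * d) * √K ^ d := by
    have h : Tendsto (fun θ : ℝ => θ ^ (3 * d) * √K ^ d) (𝓝[<] 1) (𝓝 (1 ^ (3 * d) * √K ^ d)) :=
      Tendsto.mono_left (Continuous.tendsto (by fun_prop) 1) nhdsWithin_le_nhds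
    have h2 := (h.eventually_const_lt (u := 2 ^ (d + 1) * ((d : ℝ) + 1)) (by simpa using hKd)).and
      (Ioo_mem_nhdsLT (zero_lt_one (α := ℝ)))
    obtain ⟨θ, h3, h4⟩ := h2.exists
    exact ⟨θ, h4, h3⟩
  have hsK : 0 < √K := Real.sqrt_pos.2 hK
  have hθθ : 0 < θ - θ ^ 2 := by nlinarith
  have hc : 0 < ((θ - θ ^ 2) / 2) ^ d * √K ^ d := by positivity
  refine ⟨2 * (d + 1) * 2 ^ d / (((θ - θ ^ 2) / 2) ^ d * √K ^ d), ?_⟩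
  have hρ := tendsto_coverRadius K hd
  have hq : 0 < min 1 (min (1 - θ ^ 2) (1 / θ - 1)) := by
    refine lt_min one_pos (lt_min ?_ ?_)
    · nlinarith
    · rw [sub_pos, lt_div_iff₀ hθ0]; linarith
  filter_upwards [hρ.eventually_lt_const hq, eventually_ge_atTop 2] with n hn hn2
  have hn2' : (2 : ℝ) ≤ n := by exact_mod_cast hn2
  have hlog : 0 < Real.log n := Real.log_pos (by linarith)
  have hL : 0 < Real.log n / n := by positivity
  have hpow := coverRadius_pow K hd n
  have hρ0 : 0 < coverRadius K d n := mul_pos hsK (Real.rpow_pos_of_pos hL _)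
  generalize coverRadius K d n = ρ at *
  obtain ⟨hρ1, hρ2, hρ3⟩ : ρ < 1 ∧ ρ < 1 - θ ^ 2 ∧ ρ < 1 / θ - 1 := by
    simpa only [lt_min_iff] using hn
  have hρsq : ρ ^ 2 < ρ := by nlinarith
  have hθsq : θ ^ 2 < 1 := by nlinarith
  have hh0 : 0 < (θ - θ ^ 2) * ρ / 2 := by positivity
  have hh1 : (θ - θ ^ 2) * ρ / 2 ≤ 1 := by nlinarith
  have hb0 : 0 < θ ^ 2 * ρ / 2 := by positivity
  have hb1 : θ ^ 2 * ρ / 2 ≤ ρ := by nlinarith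
  obtain ⟨T, hT, hcard⟩ := exists_sphere_net (d := d) hh0 hh1
  -- The net radius `(θ - θ ^ 2) * ρ` and the ball radius `θ ^ 2 * ρ` add up to `a = θ * ρ`. The
  -- choice of `m` makes `exp (-(n * m))` equal to `1 / n`.
  refine ⟨T, 2 * (θ ^ 2 * ρ / 2), θ * ρ, Real.log n / n, ?_, by linarith, fun x => ?_,
    fun t => ?_, ?_⟩
  · have : 0 < ρ ^ 2 * (4 * (1 - θ ^ 2) - ρ ^ 2) := mul_pos (by positivity) (by linarith)
    linarith
  · obtain ⟨t, ht, hxt⟩ := hT x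
    exact ⟨t, ht, by linarith⟩
  · refine le_trans ?_ (le_uniformSphere_ball hb0 (hb1.trans hρ1.le) t)
    rw [le_div_iff₀ (by positivity)]
    have h1 : θ * (1 + θ ^ 2 * ρ / 2) ≤ 1 := by
      rw [lt_sub_iff_add_lt, lt_div_iff₀ hθ0] at hρ3
      nlinarith
    have h2 : (θ * (1 + θ ^ 2 * ρ / 2)) ^ d ≤ 1 := pow_le_one₀ (by positivity) h1
    refine le_of_mul_le_mul_right (a := (2 : ℝ) ^ d) ?_ (by positivity)
    calc Real.log n / n * (2 * (d + 1) * (1 + θ ^ 2 * ρ / 2) ^ d) * 2 ^ d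
        = Real.log n / n * (1 + θ ^ 2 * ρ / 2) ^ d * (2 ^ (d + 1) * ((d : ℝ) + 1)) := by ring
      _ ≤ Real.log n / n * (1 + θ ^ 2 * ρ / 2) ^ d * (θ ^ (3 * d) * √K ^ d) := by gcongr
      _ = θ ^ (2 * d) * (√K ^ d * (Real.log n / n)) * (θ * (1 + θ ^ 2 * ρ / 2)) ^ d := by
        rw [mul_pow θ]; ring
      _ ≤ θ ^ (2 * d) * (√K ^ d * (Real.log n / n)) * 1 := by gcongr
      _ = (θ ^ 2 * ρ / 2) ^ d * 2 ^ d := by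
        rw [← hpow, ← mul_pow, pow_mul, mul_one, ← mul_pow]; congr 1; ring
  · have hexp : Real.exp (-(n * (Real.log n / n))) = 1 / n := by
      rw [mul_div_cancel₀ _ (by positivity), Real.exp_neg, Real.exp_log (by positivity), one_div]
    have h3 : (T.card : ℝ) * (((θ - θ ^ 2) / 2) ^ d * √K ^ d * (Real.log n / n)) ≤
        2 * (d + 1) * 2 ^ d := by
      calc _ = (T.card : ℝ) * ((θ - θ ^ 2) * ρ / 2) ^ d := by
            rw [mul_assoc (((θ - θ ^ 2) / 2) ^ d), ← hpow, ← mul_pow]; congr 2; ring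
        _ ≤ 2 * (d + 1) * (1 + (θ - θ ^ 2) * ρ / 2) ^ d := hcard
        _ ≤ _ := by
          gcongr
          linarith
    rw [hexp, le_div_iff₀ hlog, le_div_iff₀ hc]
    calc _ = (T.card : ℝ) * (((θ - θ ^ 2) / 2) ^ d * √K ^ d * (Real.log n / n)) := by ring
      _ ≤ _ := h3

end Threshold

/-! ### The chromatic number in the limit. -/

theorem mainTheorem4 (d : ℕ) (hd : 1 ≤ d)
    (Δ : Affine.Simplex ℝ (EuclideanSpace ℝ (Fin (d + 1))) (d + 1))
    (hΔ : IsRegularInscribed Δ) (τ : Fin (d + 2))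
    (ε : ℕ → ℝ)
    (hε : ∀ᶠ n : ℕ in atTop,
      (64 / 3 : ℝ) * (3 * Real.pi ^ 2 / 4) ^ (1 / (d : ℝ)) *
          (Real.log n / n) ^ (2 / (d : ℝ)) ≤ ε n ∧
        ε n ≤ 2 - facetProjDiam Δ τ)
    {Ω : ℕ → Type*} [∀ n, MeasurableSpace (Ω n)]
    (P : ∀ n, Measure (Ω n)) [∀ n, IsProbabilityMeasure (P n)]
    (X : ∀ n, Fin n → Ω n → UnitSphere d)
    (hindep : ∀ n, iIndepFun (X n) (P n))
    (hunif : ∀ n i, HasLaw (X n i) (uniformSphere d) (P n)) :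
    Tendsto
      (fun n => P n {ω | (borsukGraph (ε n) (fun i => X n i ω)).chromaticNumber = (d + 2 : ℕ)})
      atTop (𝓝 1) := by
  have hK : 0 < (64 / 3 : ℝ) * (3 * Real.pi ^ 2 / 4) ^ (1 / (d : ℝ)) := by positivity
  obtain ⟨C, hC⟩ := exists_net_parameters hd hK (two_pow_lt_sqrt_threshold_pow hd)
  have hlim : Tendsto (fun n : ℕ => ENNReal.ofReal (1 - C / Real.log n)) atTop (𝓝 1) := by
    have h1 : Tendsto (fun n : ℕ => C / Real.log n) atTop (𝓝 0) :=
      (Real.tendsto_log_atTop.comp tendsto_natCast_atTop_atTop).const_div_atTop C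
    have h2 := ENNReal.tendsto_ofReal (h1.const_sub 1)
    rwa [sub_zero, ENNReal.ofReal_one] at h2
  refine tendsto_of_tendsto_of_tendsto_of_le_of_le' hlim tendsto_const_nhds ?_
    (.of_forall fun n => prob_le_one)
  filter_upwards [hε, hC] with n ⟨hlow, hupp⟩ ⟨T, r, a, m, ha, h2, hT, hm, hbound⟩
  rw [← coverRadius_sq hK.le] at hlow
  have hbad := (measureReal_exists_ball_empty_le (hindep n) (hunif n) T hm).trans hbound
  set B : Set (Ω n) := {ω | ∃ t ∈ T, ∀ i, X n i ω ∉ Metric.ball t r}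
  have hsub : Bᶜ ⊆ {ω | (borsukGraph (ε n) (fun i => X n i ω)).chromaticNumber = (d + 2 : ℕ)} := by
    intro ω hω
    have hnot : ¬ (borsukGraph (ε n) (fun i => X n i ω)).Colorable (d + 1) := by
      refine borsukGraph_not_colorable hlow h2 ha fun y => ?_
      obtain ⟨t, ht, hyt⟩ := hT y
      by_contra! hcon
      refine hω ⟨t, ht, fun i hi => ?_⟩
      rw [Metric.mem_ball, dist_comm] at hi
      linarith [hcon i, dist_triangle y t (X n i ω)]
    exact SimpleGraph.chromaticNumber_eq_iff_colorable_not_colorable.2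
      ⟨hΔ.borsukGraph_colorable τ hupp _, hnot⟩
  refine le_trans ?_ (measure_mono hsub)
  refine ENNReal.ofReal_le_of_le_toReal ?_
  -- Subadditivity suffices here, so measurability of `B` plays no role.
  have h1 : (1 : ℝ) ≤ (P n).real B + (P n).real Bᶜ := by
    rw [← probReal_univ (μ := P n), ← Set.union_compl_self B]
    exact measureReal_union_le _ _
  rw [measureReal_def (P n) Bᶜ] at h1
  linarith
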